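/- Let $(V,\circ,\langle\cdot,\cdot\rangle)$ be a Euclidean Jordan algebra, i.e. a finite-dimensional real inner product space with a commutative bilinear product $\circ$ that has a unit element $e$, satisfies the Jordan identity $(x\circ y)\circ(x\circ x)=x\circ(y\circ(x\circ x))$, and is compatible with the inner product: $\langle x\circ y,z\rangle=\langle y,x\circ z\rangle$ for all $x,y,z$ (for example, the trace inner product $\langle x,y\rangle=\operatorname{tr}(x\circ y)$). Let $K=\{x\circ x: x\in V\}$ be its symmetric cone, with interior $K^\circ$, and let $\Delta=\{x\in K:\langle x,e\rangle=1\}$ be the set of strategies. For a linear transformation $L:V\to V$, an optimal strategy pair is a pair $(\bar x,\bar y)\in\Delta\times\Delta$ such that $$\langle L(x),\bar y\rangle\le\langle L(\bar x),\bar y\rangle\le\langle L(\bar x),y\rangle\qquad\text{for all }x,y\in\Delta .$$ The value of $L$ is the number $v(L)=\langle L(\bar x),\bar y\rangle$, where $(\bar x,\bar y)$ is any optimal strategy pair, and $L$ is completely mixed if $\bar x,\bar y\in K^\circ$ for every optimal strategy pair $(\bar x,\bar y)$. An idempotent is a nonzero $c\in V$ with $c\circ c=c$; it is primitive if it is not the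 sum of two idempotents. The quadratic representation of $c$ is $P_c(x)=2\,c\circ(c\circ x)-(c\circ c)\circ x$. Theorem. Let $L$ be a linear transformation on $V$ with $v(L)=0$. Then $L$ is completely mixed if and only if $v(L+P_c)>0$ (the value existing) for every primitive idempotent $c$ in $V$. -/

import Mathlib

/-- A Euclidean Jordan algebra: a real inner product space (finite dimensionality is a separate
instance argument) with a commutative bilinear product `x * y` that has a unit element `1`,
satisfies the Jordan identity, and is compatible with the inner product. -/
class EuclideanJordanAlgebra (V : Type*) [NormedAddCommGroup V] [InnerProductSpace ℝ V] extends
    CommMagma V, MulOneClass V, IsCommJordan V where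
  protected mul_add : ∀ x y z : V, x * (y + z) = x * y + x * z
  protected mul_smul : ∀ (r : ℝ) (x y : V), x * (r • y) = r • (x * y)
  inner_mul_left : ∀ x y z : V, inner ℝ (x * y) z = inner ℝ y (x * z)

namespace EuclideanJordanAlgebra

section Algebra

variable {V : Type*} [NormedAddCommGroup V] [InnerProductSpace ℝ V] [EuclideanJordanAlgebra V]

/-- The symmetric cone `{x ∘ x : x ∈ V}`. -/
def symmetricCone (V : Type*) [NormedAddCommGroup V] [InnerProductSpace ℝ V]
    [EuclideanJordanAlgebra V] : Set V :=
  {z | ∃ x : V, z = x * x}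

/-- A primitive idempotent: a nonzero `c` with `c ∘ c = c` that is not the sum of two
nonzero idempotents. -/
structure IsPrimitiveIdempotent (c : V) : Prop where
  ne_zero : c ≠ 0
  isIdempotentElem : IsIdempotentElem c
  add_ne : ∀ a b : V, a ≠ 0 → IsIdempotentElem a → b ≠ 0 → IsIdempotentElem b → a + b ≠ c

/-- The quadratic representation `P_a(x) = 2 a ∘ (a ∘ x) - (a ∘ a) ∘ x`. -/
def quadraticRep (a : V) : V →ₗ[ℝ] V where
  toFun x := (2 : ℝ) • (a * (a * x)) - (a * a) * x
  map_add' x y := by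
    simp only [EuclideanJordanAlgebra.mul_add, smul_add]
    abel
  map_smul' r x := by
    simp only [EuclideanJordanAlgebra.mul_smul, RingHom.id_apply, smul_sub, smul_comm r (2 : ℝ)]

end Algebra

section Game

variable {V : Type*} [NormedAddCommGroup V] [InnerProductSpace ℝ V]

/-- The strategy set `Δ(e) = {x ∈ K : ⟨x, e⟩ = 1}`. -/
def strategies (K : Set V) (e : V) : Set V :=
  {x | x ∈ K ∧ inner ℝ x e = 1}

/-- `(x, y)` is an optimal strategy pair of the linear game `(L, e)` over the cone `K`. -/
structure IsOptimalPair (K : Set V) (e : V) (L : V →ₗ[ℝ] V) (x y : V) : Prop where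
  left_mem : x ∈ strategies K e
  right_mem : y ∈ strategies K e
  le_payoff : ∀ x' ∈ strategies K e, inner ℝ (L x') y ≤ inner ℝ (L x) y
  payoff_le : ∀ y' ∈ strategies K e, inner ℝ (L x) y ≤ inner ℝ (L x) y'

/-- `v` is the value of the game `(L, e)`: the pay-off `⟨L x, y⟩` at an optimal strategy pair. -/
def IsValue (K : Set V) (e : V) (L : V →ₗ[ℝ] V) (v : ℝ) : Prop :=
  ∃ x y : V, IsOptimalPair K e L x y ∧ v = inner ℝ (L x) y

/-- The value does not depend on the optimal pair. -/
theorem IsValue.unique {K : Set V} {e : V} {L : V →ₗ[ℝ] V} {v w : ℝ}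
    (hv : IsValue K e L v) (hw : IsValue K e L w) : v = w := by
  obtain ⟨x, y, h, rfl⟩ := hv
  obtain ⟨x', y', h', rfl⟩ := hw
  exact le_antisymm
    ((h.payoff_le y' h'.right_mem).trans (h'.le_payoff x h.left_mem))
    ((h'.payoff_le y h.right_mem).trans (h.le_payoff x' h'.left_mem))

/-- The game `(L, e)` is completely mixed: in every optimal strategy pair, both strategies lie in
the interior of `K`. -/
def IsCompletelyMixed (K : Set V) (e : V) (L : V →ₗ[ℝ] V) : Prop :=
  ∀ x y : V, IsOptimalPair K e L x y → x ∈ interior K ∧ y ∈ interior K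

end Game

end EuclideanJordanAlgebra

/-! For value 0, `(x, y)` is optimal iff `x, y ∈ Δ`, `L x` is nonnegative on `K`, and `-Lᵀ y` is too
(`isOptimalPair_iff`). For primitive `c` the Peirce 1-space is `ℝ c`, so `P_c` adds the rank-one
term `⟨c,x⟩⟨c,y⟩/⟨c,c⟩ ≥ 0` to the payoff.

Forward: were `v(L + P_c) ≤ 0`, its optimal `y'` would be optimal for `L` too. Complete mixedness
makes the added term positive at `(x, y')`, while `⟨L x, y'⟩ ≥ 0`, a contradiction.

Converse: an optimal `y` on the boundary is orthogonal to some primitive `c`, so it holds the payoff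
of `L + P_c` to at most 0; hence every optimal `y` is interior, which forces `L x = 0`. Were `x` on
the boundary, a dimension count would give a direction along which `y` stays optimal until it hits
the boundary.

The cone geometry comes from the spectral decomposition, which rests on power associativity. -/

namespace EuclideanJordanAlgebra

open Polynomial

/-! ### Power associativity and spectral decomposition. -/

section Spectral

variable {V : Type*} [NormedAddCommGroup V] [InnerProductSpace ℝ V] [EuclideanJordanAlgebra V]

scoped instance : NonUnitalNonAssocCommRing V where
  left_distrib := EuclideanJordanAlgebra.mul_add
  right_distrib x y z := by
    rw [mul_comm, EuclideanJordanAlgebra.mul_add, mul_comm z x, mul_comm z y]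
  zero_mul x := by
    have h := EuclideanJordanAlgebra.mul_smul (0 : ℝ) x (0 : V)
    rwa [zero_smul, zero_smul, mul_comm] at h
  mul_zero x := by
    have h := EuclideanJordanAlgebra.mul_smul (0 : ℝ) x (0 : V)
    rwa [zero_smul, zero_smul] at h
  mul_comm := mul_comm

scoped instance : SMulCommClass ℝ V V where
  smul_comm r x y := (EuclideanJordanAlgebra.mul_smul r x y).symm

scoped instance : IsScalarTower ℝ V V where
  smul_assoc r x y := by
    rw [smul_eq_mul, smul_eq_mul, mul_comm, EuclideanJordanAlgebra.mul_smul, mul_comm]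

/-- The multiplication operators `L_a : x ↦ a ∘ x`, as a linear map in `a`. -/
def lmul (V : Type*) [NormedAddCommGroup V] [InnerProductSpace ℝ V] [EuclideanJordanAlgebra V] :
    V →ₗ[ℝ] Module.End ℝ V :=
  LinearMap.mul ℝ V

@[simp]
theorem lmul_apply (a x : V) : lmul V a x = a * x := rfl

theorem lmul_isSymmetric (a : V) : (lmul V a).IsSymmetric := fun x y => inner_mul_left a x y

/-- The linearised Jordan identity. -/
theorem linearized_jordan (a b c d : V) :
    a * ((b * c) * d) + b * ((c * a) * d) + c * ((a * b) * d) =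
      (b * c) * (a * d) + (c * a) * (b * d) + (a * b) * (c * d) := by
  have h := congrArg (fun f : AddMonoid.End V => f d)
    (two_nsmul_lie_lmul_lmul_add_add_eq_zero a b c)
  have h2 : (2 : ℕ) • ((a * ((b * c) * d) + b * ((c * a) * d) + c * ((a * b) * d)) -
      ((b * c) * (a * d) + (c * a) * (b * d) + (a * b) * (c * d))) = 0 := by
    refine Eq.trans ?_ h
    change _ = (2 : ℕ) • ((a * ((b * c) * d) - (b * c) * (a * d)) +
      (b * ((c * a) * d) - (c * a) * (b * d)) + (c * ((a * b) * d) - (a * b) * (c * d)))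
    congr 1
    abel
  rw [← Nat.cast_smul_eq_nsmul ℝ] at h2
  exact sub_eq_zero.1 ((smul_eq_zero.1 h2).resolve_left (by norm_num))

/-- The right side of `linearized_jordan` is symmetric under `a ↔ d`, so its left side is too. -/
theorem mul_mul_mul_expand (a b c d : V) :
    (a * (b * c)) * d = a * ((b * c) * d) + b * ((c * a) * d) + c * ((a * b) * d)
      - b * (a * (c * d)) - c * (a * (b * d)) := by
  have h1 := linearized_jordan a b c d
  have h2 := linearized_jordan d b c a
  rw [h1]
  have e1 : d * ((b * c) * a) = (a * (b * c)) * d := by rw [mul_comm d, mul_comm _ a]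
  have e2 : b * ((c * d) * a) = b * (a * (c * d)) := by rw [mul_comm a]
  have e3 : c * ((d * b) * a) = c * (a * (b * d)) := by rw [mul_comm a, mul_comm d]
  rw [e1, e2, e3] at h2
  have e4 : (b * c) * (d * a) + (c * d) * (b * a) + (d * b) * (c * a) =
    (b * c) * (a * d) + (c * a) * (b * d) + (a * b) * (c * d) := by
    rw [mul_comm d a, mul_comm d b, mul_comm (c * d), mul_comm (b * d), mul_comm b a]; abel
  rw [e4] at h2
  rw [← h2]; abel

theorem lmul_mul_mul (a b c : V) :
    lmul V (a * (b * c)) = lmul V a * lmul V (b * c) + lmul V b * lmul V (c * a)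
      + lmul V c * lmul V (a * b) - lmul V b * lmul V a * lmul V c
      - lmul V c * lmul V a * lmul V b := by
  ext d
  simp [mul_mul_mul_expand a b c d]

theorem commute_lmul_sq (a : V) : Commute (lmul V a) (lmul V (a * a)) := by
  ext x
  simp only [Module.End.mul_apply, lmul_apply]
  have := IsCommJordan.lmul_comm_rmul_rmul a x
  rw [mul_comm (a * a) x, ← this, mul_comm]

/-- The evaluation of a polynomial at an element of a Jordan algebra. -/
noncomputable def polyEval (x : V) (p : ℝ[X]) : V := aeval (lmul V x) p 1

/-- By `lmul_mul_mul`, multiplication by `x^(n+2)` is built from those by `x`, `x²`, `x^n` and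
`x^(n+1)`; the induction therefore carries two consecutive powers. -/
theorem lmul_pow_commute (x : V) (n : ℕ) :
    (Commute (lmul V x) (lmul V ((lmul V x ^ n) 1)) ∧
      Commute (lmul V (x * x)) (lmul V ((lmul V x ^ n) 1))) ∧
    (Commute (lmul V x) (lmul V ((lmul V x ^ (n + 1)) 1)) ∧
      Commute (lmul V (x * x)) (lmul V ((lmul V x ^ (n + 1)) 1))) := by
  have hc := commute_lmul_sq x
  induction n with
  | zero =>
    have h1 : lmul V (1 : V) = 1 := by ext; simp
    simp [h1, hc.symm]
  | succ n ih =>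
    refine ⟨ih.2, ?_⟩
    set y := (lmul V x ^ n) 1 with hy
    have e1 : (lmul V x ^ (n + 1)) 1 = x * y := by
      rw [pow_succ', Module.End.mul_apply, lmul_apply]
    have e2 : (lmul V x ^ (n + 1 + 1)) 1 = x * (x * y) := by
      rw [pow_succ', Module.End.mul_apply, lmul_apply, e1]
    rw [e1] at ih
    rw [e2, lmul_mul_mul, mul_comm y x]
    obtain ⟨⟨h1, h2⟩, h3, h4⟩ := ih
    have hr := Commute.refl (lmul V x)
    have hr' := Commute.refl (lmul V (x * x))
    exact ⟨((((hr.mul_right h3).add_right (hr.mul_right h3)).add_right (h1.mul_right hc)).sub_right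
      ((hr.mul_right hr).mul_right h1)).sub_right ((h1.mul_right hr).mul_right hr),
      ((((hc.symm.mul_right h4).add_right (hc.symm.mul_right h4)).add_right
      (h2.mul_right hr')).sub_right ((hc.symm.mul_right hc.symm).mul_right h2)).sub_right
      ((h2.mul_right hc.symm).mul_right hc.symm)⟩

theorem commute_lmul_polyEval (x : V) (p : ℝ[X]) :
    Commute (lmul V x) (lmul V (polyEval x p)) := by
  induction p using Polynomial.induction_on' with
  | add p q hp hq => simpa [polyEval] using hp.add_right hq
  | monomial n a =>
    have := (lmul_pow_commute x n).1.1
    simpa [polyEval, aeval_monomial, Algebra.algebraMap_eq_smul_one] using this.smul_right a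

/-- Power associativity. -/
theorem polyEval_mul (x : V) (p q : ℝ[X]) :
    polyEval x p * polyEval x q = polyEval x (p * q) := by
  -- Evaluating this commutation at `1` gives the claim.
  have h : Commute (aeval (lmul V x) q) (lmul V (polyEval x p)) :=
    Polynomial.induction_on' (motive := fun q => Commute (aeval (lmul V x) q) _) q
      (fun p q hp hq => by simpa using hp.add_left hq)
      (fun n a => by
        simpa [aeval_monomial, Algebra.algebraMap_eq_smul_one] using
          ((commute_lmul_polyEval x p).pow_left n).smul_left a)
  have h1 := congrArg (fun f : Module.End ℝ V => f 1) h.eq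
  simp only [Module.End.mul_apply, lmul_apply, mul_one] at h1
  rw [mul_comm p q, polyEval, polyEval, polyEval, map_mul, Module.End.mul_apply]
  exact h1.symm

theorem polyEval_X (x : V) : polyEval x X = x := by simp [polyEval]

variable [FiniteDimensional ℝ V]

/-- In an eigenbasis, a polynomial in `T` is determined by its values on the spectrum. -/
theorem aeval_eq_of_isSymmetric {E : Type*} [NormedAddCommGroup E] [InnerProductSpace ℝ E]
    [FiniteDimensional ℝ E] {T : Module.End ℝ E} (hT : T.IsSymmetric) {p q : ℝ[X]}
    (h : ∀ μ, T.HasEigenvalue μ → p.eval μ = q.eval μ) : aeval T p = aeval T q := by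
  refine (hT.eigenvectorBasis rfl).toBasis.ext fun i => ?_
  have hv := hT.hasEigenvector_eigenvectorBasis rfl i
  simp only [OrthonormalBasis.coe_toBasis]
  rw [Module.End.aeval_apply_of_hasEigenvector hv, Module.End.aeval_apply_of_hasEigenvector hv,
    h _ (Module.End.hasEigenvalue_of_hasEigenvector hv)]

theorem inner_self_nonneg_of_eigenvalues {E : Type*} [NormedAddCommGroup E]
    [InnerProductSpace ℝ E] [FiniteDimensional ℝ E] {T : Module.End ℝ E} (hT : T.IsSymmetric)
    (h : ∀ μ, T.HasEigenvalue μ → 0 ≤ μ) (z : E) : 0 ≤ inner ℝ (T z) z := by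
  have hn : Module.finrank ℝ E = Module.finrank ℝ E := rfl
  rw [← (hT.eigenvectorBasis hn).sum_inner_mul_inner (T z) z]
  refine Finset.sum_nonneg fun i _ => ?_
  rw [hT, hT.apply_eigenvectorBasis, inner_smul_right, real_inner_comm, mul_assoc]
  exact mul_nonneg (h _ (hT.hasEigenvalue_eigenvalues hn i)) (mul_self_nonneg _)

/-- Spectral decomposition. -/
theorem exists_spectral_decomposition (x : V) :
    ∃ (S : Finset ℝ) (p : ℝ → ℝ[X]), (∀ s ∈ S, IsIdempotentElem (polyEval x (p s))) ∧
      (∀ s ∈ S, s ≠ 0 → (p s).eval 0 = 0) ∧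
      x = ∑ s ∈ S, s • polyEval x (p s) ∧ x * x = ∑ s ∈ S, s ^ 2 • polyEval x (p s) := by
  classical
  have hT := lmul_isSymmetric x
  -- Including the node 0 makes the Lagrange polynomials of the other nodes vanish at 0. Some of the
  -- resulting idempotents may be zero.
  set S : Finset ℝ := insert 0 (lmul V x).finite_hasEigenvalue.toFinset with hS
  have hmem : ∀ μ, (lmul V x).HasEigenvalue μ → μ ∈ S := fun μ h => by simp [hS, h]
  have key : ∀ f : ℝ[X], polyEval x f =
      ∑ s ∈ S, f.eval s • polyEval x (Lagrange.basis S id s) := by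
    intro f
    have h1 : aeval (lmul V x) f =
        aeval (lmul V x) (∑ s ∈ S, C (f.eval s) * Lagrange.basis S id s) := by
      refine aeval_eq_of_isSymmetric hT fun μ hμ => ?_
      rw [eval_finsetSum, Finset.sum_eq_single μ]
      · have := Lagrange.eval_basis_self (s := S) (v := (id : ℝ → ℝ)) (by simp) (hmem μ hμ)
        simp only [id] at this
        simp [this]
      · intro b _ hb
        have := Lagrange.eval_basis_of_ne (v := (id : ℝ → ℝ)) hb (hmem μ hμ)
        simp only [id] at this
        simp [this]
      · exact fun h => absurd (hmem μ hμ) h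
    rw [polyEval, h1]
    simp [polyEval, Algebra.algebraMap_eq_smul_one]
  refine ⟨S, Lagrange.basis S id, fun s hs => ?_, fun s hs h0 => ?_, ?_, ?_⟩
  · rw [IsIdempotentElem, polyEval_mul, polyEval, polyEval]
    congr 1
    refine aeval_eq_of_isSymmetric hT fun μ hμ => ?_
    rw [eval_mul]
    by_cases h : s = μ
    · subst h
      have := Lagrange.eval_basis_self (s := S) (v := (id : ℝ → ℝ)) (by simp) hs
      simp only [id] at this
      simp [this]
    · have := Lagrange.eval_basis_of_ne (v := (id : ℝ → ℝ)) h (hmem μ hμ)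
      simp only [id] at this
      simp [this]
  · exact Lagrange.eval_basis_of_ne (v := (id : ℝ → ℝ)) h0 (by simp [hS])
  · simpa [polyEval_X] using key X
  · have := key (X ^ 2)
    rw [sq, ← polyEval_mul, polyEval_X] at this
    simpa [sq] using this

end Spectral
end EuclideanJordanAlgebra

namespace EuclideanJordanAlgebra

open Polynomial Topology

/-! ### The symmetric cone and primitive idempotents. -/

section Cone

variable {V : Type*} [NormedAddCommGroup V] [InnerProductSpace ℝ V] [EuclideanJordanAlgebra V]

theorem inner_mul_right (x y z : V) : inner ℝ y (x * z) = inner ℝ (x * y) z :=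
  (inner_mul_left x y z).symm

theorem inner_mul_self_right (x z : V) : inner ℝ x (z * z) = inner ℝ (x * z) z := by
  rw [inner_mul_right, mul_comm]

theorem inner_one_of_isIdempotentElem {e : V} (he : IsIdempotentElem e) :
    inner ℝ e 1 = inner ℝ e e := by
  have h := inner_mul_left e e 1
  rwa [he.eq, mul_one] at h

theorem mul_eq_zero_of_isIdempotentElem_add {a b : V} (ha : IsIdempotentElem a)
    (hb : IsIdempotentElem b) (hab : IsIdempotentElem (a + b)) : a * b = 0 := by
  have h := hab.eq
  rw [add_mul, mul_add, mul_add, ha.eq, hb.eq, mul_comm b a] at h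
  have h2 : (2 : ℝ) • (a * b) = 0 := by
    rw [two_smul]
    have : a * b + a * b = (a + a * b + (a * b + b)) - (a + b) := by abel
    rw [this, h, sub_self]
  exact (smul_eq_zero.1 h2).resolve_left (by norm_num)

theorem isIdempotentElem_mem_symmetricCone {e : V} (he : IsIdempotentElem e) :
    e ∈ symmetricCone V := ⟨e, he.eq.symm⟩

theorem exists_pos_sub_smul_mem {x : V} (hx : x ∈ interior (symmetricCone V)) :
    ∃ ε : ℝ, 0 < ε ∧ ∀ u : V, ‖u‖ ≤ 1 → x - ε • u ∈ symmetricCone V := by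
  obtain ⟨δ, hδ, hb⟩ := Metric.mem_nhds_iff.1 (mem_interior_iff_mem_nhds.1 hx)
  refine ⟨δ / 2, by positivity, fun u hu => hb ?_⟩
  rw [Metric.mem_ball, dist_eq_norm, sub_sub_cancel_left, norm_neg, norm_smul, Real.norm_of_nonneg
    (by positivity)]
  nlinarith [norm_nonneg u]

theorem quadraticRep_apply_idempotent {c : V} (hc : IsIdempotentElem c) (x : V) :
    quadraticRep c x = (2 : ℝ) • (c * (c * x)) - c * x := by
  change (2 : ℝ) • (c * (c * x)) - (c * c) * x = _
  rw [hc.eq]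

theorem IsPrimitiveIdempotent.mem {c : V} (hc : IsPrimitiveIdempotent c) :
    c ∈ symmetricCone V :=
  isIdempotentElem_mem_symmetricCone hc.isIdempotentElem

/-- Pairing an interior point with something nonnegative on the cone dominates the norm. -/
theorem exists_pos_mul_norm_le_inner {x : V} (hx : x ∈ interior (symmetricCone V)) :
    ∃ ε : ℝ, 0 < ε ∧ ∀ z : V, (∀ y ∈ symmetricCone V, 0 ≤ inner ℝ z y) →
      ε * ‖z‖ ≤ inner ℝ z x := by
  obtain ⟨ε, hε, h⟩ := exists_pos_sub_smul_mem hx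
  refine ⟨ε, hε, fun z hz => ?_⟩
  by_cases h0 : z = 0
  · simp [h0]
  have := hz _ (h (‖z‖⁻¹ • z) (by simp [norm_smul, h0]))
  rw [inner_sub_right, real_inner_smul_right, real_inner_smul_right, real_inner_self_eq_norm_sq,
    sq, inv_mul_cancel_left₀ (norm_ne_zero_iff.2 h0)] at this
  linarith

theorem eq_zero_of_inner_interior_eq_zero {x z : V} (hx : x ∈ interior (symmetricCone V))
    (hz : ∀ y ∈ symmetricCone V, 0 ≤ inner ℝ z y) (h : inner ℝ z x = 0) : z = 0 := by
  obtain ⟨ε, hε, hb⟩ := exists_pos_mul_norm_le_inner hx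
  have := hb z hz
  rw [h] at this
  exact norm_le_zero_iff.1 (nonpos_of_mul_nonpos_right this hε)

variable [FiniteDimensional ℝ V]

/-- Multiplication by an idempotent has eigenvalues in `{0, 1/2, 1}`. -/
theorem inner_idempotent_mul_self_nonneg {e : V} (he : IsIdempotentElem e) (z : V) :
    0 ≤ inner ℝ (e * z) z := by
  refine inner_self_nonneg_of_eigenvalues (lmul_isSymmetric e) (fun μ hμ => ?_) z
  obtain ⟨v, hv⟩ := hμ.exists_hasEigenvector
  -- At `a = b = c = e` the expansion reads `L_e = 3 L_e² - 2 L_e³`, hence the cubic equation for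
  -- `μ`.
  have h := congrArg (fun f : Module.End ℝ V => f v) (lmul_mul_mul e e e)
  have hev : e * v = μ • v := hv.apply_eq_smul
  have hs : ∀ r : ℝ, e * (r • v) = (r * μ) • v := fun r => by rw [mul_smul_comm, hev, smul_smul]
  simp only [he.eq, LinearMap.sub_apply, LinearMap.add_apply, Module.End.mul_apply, lmul_apply,
    hev, hs, ← add_smul, ← sub_smul] at h
  have h2 := smul_left_injective ℝ hv.2 h
  have : μ * ((2 * μ - 1) * (μ - 1)) = 0 := by nlinarith
  by_contra! hneg
  rcases mul_eq_zero.1 this with h3 | h3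
  · linarith
  · nlinarith

/-- A square is a combination of idempotents with coefficients `s²`, each acting positively.
Conversely, a polynomial interpolating the square root on the spectrum of `L_x` gives a root of `x`.
Thus the cone is an intersection of closed half-spaces. -/
theorem mem_symmetricCone_iff {x : V} :
    x ∈ symmetricCone V ↔ ∀ z, 0 ≤ inner ℝ (x * z) z := by
  constructor
  · rintro ⟨w, rfl⟩ z
    obtain ⟨S, p, hp, -, -, hw⟩ := exists_spectral_decomposition w
    rw [hw, Finset.sum_mul, sum_inner]
    refine Finset.sum_nonneg fun s hs => ?_
    rw [smul_mul_assoc, real_inner_smul_left]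
    exact mul_nonneg (sq_nonneg s) (inner_idempotent_mul_self_nonneg (hp s hs) z)
  · intro h
    have hT := lmul_isSymmetric x
    classical
    set S := (lmul V x).finite_hasEigenvalue.toFinset with hS
    have hpos : ∀ μ, (lmul V x).HasEigenvalue μ → 0 ≤ μ := fun μ hμ =>
      eigenvalue_nonneg_of_nonneg hμ fun z => by
        rw [real_inner_comm]
        exact h z
    set f := Lagrange.interpolate S id Real.sqrt
    refine ⟨polyEval x f, ?_⟩
    rw [polyEval_mul]
    conv_lhs => rw [← polyEval_X x]
    rw [polyEval, polyEval]
    congr 1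
    refine aeval_eq_of_isSymmetric hT fun μ hμ => ?_
    have hμS : μ ∈ S := by simpa [hS] using hμ
    have := Lagrange.eval_interpolate_at_node (s := S) (v := (id : ℝ → ℝ)) Real.sqrt (by simp) hμS
    simp only [id] at this
    rw [eval_X, eval_mul, this, Real.mul_self_sqrt (hpos μ hμ)]

theorem inner_nonneg_of_mem_symmetricCone {x y : V} (hx : x ∈ symmetricCone V)
    (hy : y ∈ symmetricCone V) : 0 ≤ inner ℝ x y := by
  obtain ⟨z, rfl⟩ := hy
  rw [inner_mul_self_right]
  exact mem_symmetricCone_iff.1 hx z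

theorem add_mem_symmetricCone {x y : V} (hx : x ∈ symmetricCone V) (hy : y ∈ symmetricCone V) :
    x + y ∈ symmetricCone V := by
  rw [mem_symmetricCone_iff] at *
  intro z
  rw [add_mul, inner_add_left]
  exact add_nonneg (hx z) (hy z)

theorem smul_mem_symmetricCone {x : V} (hx : x ∈ symmetricCone V) {r : ℝ} (hr : 0 ≤ r) :
    r • x ∈ symmetricCone V := by
  rw [mem_symmetricCone_iff] at *
  intro z
  rw [smul_mul_assoc, real_inner_smul_left]
  exact mul_nonneg hr (hx z)

theorem convex_symmetricCone : Convex ℝ (symmetricCone V) := fun _ hx _ hy _ _ ha hb _ =>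
  add_mem_symmetricCone (smul_mem_symmetricCone hx ha) (smul_mem_symmetricCone hy hb)

theorem continuous_mul : Continuous fun p : V × V => p.1 * p.2 := by
  let T : V →L[ℝ] V →L[ℝ] V :=
    LinearMap.toContinuousLinearMap (LinearMap.toContinuousLinearMap.toLinearMap ∘ₗ lmul V)
  exact (T.continuous.comp continuous_fst).clm_apply continuous_snd

theorem isClosed_symmetricCone : IsClosed (symmetricCone V) := by
  have : symmetricCone V = ⋂ z : V, {x | 0 ≤ inner ℝ (x * z) z} := by
    ext x
    simp [mem_symmetricCone_iff]
  rw [this]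
  refine isClosed_iInter fun z => isClosed_le continuous_const ?_
  exact (continuous_mul.comp (continuous_id.prodMk continuous_const)).inner continuous_const

/-- Compactness of the unit sphere makes strict positivity survive small perturbations of `x`. -/
theorem mem_interior_symmetricCone_of_pos {x : V} (h : ∀ z : V, z ≠ 0 → 0 < inner ℝ (x * z) z) :
    x ∈ interior (symmetricCone V) := by
  rw [mem_interior_iff_mem_nhds]
  have hcont : Continuous fun p : V × V => (inner ℝ (p.1 * p.2) p.2 : ℝ) :=
    continuous_mul.inner continuous_snd
  have := (isCompact_sphere (0 : V) 1).eventually_forall_of_forall_eventually (x₀ := x)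
    (P := fun x z => 0 < inner ℝ (x * z) z) fun z hz =>
      hcont.continuousAt.eventually (lt_mem_nhds (h z (ne_zero_of_mem_unit_sphere ⟨z, hz⟩)))
  filter_upwards [this] with w hw
  rw [mem_symmetricCone_iff]
  intro z
  by_cases hz : z = 0
  · simp [hz]
  · have h1 := hw (‖z‖⁻¹ • z) (by simp [norm_smul, hz])
    rw [mul_smul_comm, real_inner_smul_left, real_inner_smul_right, ← mul_assoc] at h1
    exact (pos_of_mul_pos_right h1 (by positivity)).le

theorem one_mem_interior : (1 : V) ∈ interior (symmetricCone V) :=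
  mem_interior_symmetricCone_of_pos fun z hz => by
    rw [one_mul]
    exact real_inner_self_pos.2 hz

theorem isCompact_strategies : IsCompact (strategies (symmetricCone V) (1 : V)) := by
  refine Metric.isCompact_of_isClosed_isBounded ?_ ?_
  · exact isClosed_symmetricCone.inter
      (isClosed_eq (continuous_id.inner continuous_const) continuous_const)
  · obtain ⟨ε, hε, h⟩ := exists_pos_mul_norm_le_inner (one_mem_interior (V := V))
    refine (Metric.isBounded_closedBall (x := (0 : V)) (r := ε⁻¹)).subset fun x hx => ?_
    have := h x fun y hy => inner_nonneg_of_mem_symmetricCone hx.1 hy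
    rw [hx.2] at this
    rw [mem_closedBall_zero_iff, ← one_div, le_div_iff₀ hε, mul_comm]
    exact this

theorem convex_strategies : Convex ℝ (strategies (symmetricCone V) (1 : V)) := by
  intro x hx y hy a b ha hb hab
  refine ⟨convex_symmetricCone hx.1 hy.1 ha hb hab, ?_⟩
  rw [inner_add_left, real_inner_smul_left, real_inner_smul_left, hx.2, hy.2]
  linarith

theorem inner_one_pos {x : V} (hx : x ∈ symmetricCone V) (h0 : x ≠ 0) : 0 < inner ℝ x 1 := by
  refine lt_of_le_of_ne (inner_nonneg_of_mem_symmetricCone hx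
    (isIdempotentElem_mem_symmetricCone IsIdempotentElem.one)) fun h => h0 ?_
  exact eq_zero_of_inner_interior_eq_zero one_mem_interior
    (fun y hy => inner_nonneg_of_mem_symmetricCone hx hy) h.symm

theorem exists_smul_mem_strategies {x : V} (hx : x ∈ symmetricCone V) (h0 : x ≠ 0) :
    (inner ℝ x 1 : ℝ)⁻¹ • x ∈ strategies (symmetricCone V) (1 : V) := by
  have h := inner_one_pos hx h0
  refine ⟨smul_mem_symmetricCone hx (inv_nonneg.2 h.le), ?_⟩
  rw [real_inner_smul_left, inv_mul_cancel₀ h.ne']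

/-- A functional that is nonnegative on strategies is nonnegative on the cone. -/
theorem inner_nonneg_of_strategies {z : V}
    (h : ∀ y ∈ strategies (symmetricCone V) (1 : V), 0 ≤ inner ℝ z y) {y : V}
    (hy : y ∈ symmetricCone V) : 0 ≤ inner ℝ z y := by
  by_cases h0 : y = 0
  · simp [h0]
  have := h _ (exists_smul_mem_strategies hy h0)
  rw [real_inner_smul_right] at this
  exact nonneg_of_mul_nonneg_right this (inv_pos.2 (inner_one_pos hy h0))

/-- A boundary point of the cone is orthogonal to a nonzero idempotent. -/
theorem exists_isIdempotentElem_inner_eq_zero {x : V} (hx : x ∈ symmetricCone V)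
    (hx' : x ∉ interior (symmetricCone V)) :
    ∃ c : V, c ≠ 0 ∧ IsIdempotentElem c ∧ inner ℝ x c = 0 := by
  have h : ∃ z : V, z ≠ 0 ∧ inner ℝ (x * z) z ≤ 0 := by
    by_contra! h
    exact hx' (mem_interior_symmetricCone_of_pos h)
  obtain ⟨z, hz, hxz⟩ := h
  obtain ⟨S, p, hp, -, hz1, hzz⟩ := exists_spectral_decomposition z
  -- Now `⟨x, z²⟩` is a sum of nonnegative terms `s² ⟨x, c_s⟩` with total at most 0, so every term
  -- vanishes.
  rw [← inner_mul_self_right, hzz, inner_sum] at hxz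
  have hnn : ∀ s ∈ S, 0 ≤ (inner ℝ x (s ^ 2 • polyEval z (p s)) : ℝ) := fun s hs =>
    inner_nonneg_of_mem_symmetricCone hx
      (smul_mem_symmetricCone (isIdempotentElem_mem_symmetricCone (hp s hs)) (sq_nonneg s))
  have h0 := (Finset.sum_eq_zero_iff_of_nonneg hnn).1 (le_antisymm hxz (Finset.sum_nonneg hnn))
  obtain ⟨s, hs, hs0⟩ := Finset.exists_ne_zero_of_sum_ne_zero (hz1 ▸ hz)
  rw [Ne, smul_eq_zero, not_or] at hs0
  refine ⟨_, hs0.2, hp s hs, ?_⟩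
  have := h0 s hs
  rw [real_inner_smul_right] at this
  exact (mul_eq_zero.1 this).resolve_left (pow_ne_zero 2 hs0.1)

/-- Since `‖c‖² = ⟨c, 1⟩ ≥ ε ‖c‖`. This turns `c ≠ 0` into a closed condition for the compactness
argument below. -/
theorem exists_pos_le_norm_of_isIdempotentElem :
    ∃ ε : ℝ, 0 < ε ∧ ∀ c : V, c ≠ 0 → IsIdempotentElem c → ε ≤ ‖c‖ := by
  obtain ⟨ε, hε, h⟩ := exists_pos_mul_norm_le_inner (one_mem_interior (V := V))
  refine ⟨ε, hε, fun c h0 hc => ?_⟩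
  have := h c fun y hy =>
    inner_nonneg_of_mem_symmetricCone (isIdempotentElem_mem_symmetricCone hc) hy
  rw [inner_one_of_isIdempotentElem hc, real_inner_self_eq_norm_sq, sq] at this
  exact le_of_mul_le_mul_right this (norm_pos_iff.2 h0)

/-- A boundary point of the cone is orthogonal to a primitive idempotent. -/
theorem exists_isPrimitiveIdempotent_inner_eq_zero {x : V} (hx : x ∈ symmetricCone V)
    (hx' : x ∉ interior (symmetricCone V)) :
    ∃ c : V, IsPrimitiveIdempotent c ∧ inner ℝ x c = 0 := by
  obtain ⟨ε, hε, hb⟩ := exists_pos_le_norm_of_isIdempotentElem (V := V)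
  obtain ⟨c₀, h0, hc₀, hxc₀⟩ := exists_isIdempotentElem_inner_eq_zero hx hx'
  have hclosed : IsClosed {c : V | ε ≤ ‖c‖ ∧ c * c = c ∧ inner ℝ x c = 0} :=
    (isClosed_le continuous_const continuous_norm).inter
      ((isClosed_eq (continuous_mul.comp (continuous_id.prodMk continuous_id)) continuous_id).inter
        (isClosed_eq (continuous_const.inner continuous_id) continuous_const))
  have hcomp : IsCompact {c : V | ε ≤ ‖c‖ ∧ c * c = c ∧ inner ℝ x c = 0} := by
    refine Metric.isCompact_of_isClosed_isBounded hclosed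
      ((Metric.isBounded_closedBall (x := (0 : V)) (r := ‖(1 : V)‖)).subset fun c hc => ?_)
    rw [mem_closedBall_zero_iff]
    have h1 := real_inner_le_norm c 1
    rw [inner_one_of_isIdempotentElem hc.2.1, real_inner_self_eq_norm_sq, sq] at h1
    exact le_of_mul_le_mul_left h1 (hε.trans_le hc.1)
  -- A shortest such idempotent is primitive: the summands of a splitting are orthogonal to each
  -- other and to `x`, hence strictly shorter.
  obtain ⟨c, ⟨h1, h2, h3⟩, hmin⟩ := hcomp.exists_isMinOn ⟨c₀, hb c₀ h0 hc₀, hc₀, hxc₀⟩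
    continuous_norm.continuousOn
  refine ⟨c, ⟨norm_pos_iff.1 (hε.trans_le h1), h2, fun a b ha hai hbn hbi hab => ?_⟩, h3⟩
  have hxa := inner_nonneg_of_mem_symmetricCone hx (isIdempotentElem_mem_symmetricCone hai)
  have hxb := inner_nonneg_of_mem_symmetricCone hx (isIdempotentElem_mem_symmetricCone hbi)
  rw [← hab, inner_add_right] at h3
  have hle : ‖c‖ ≤ ‖a‖ := hmin ⟨hb a ha hai, hai, by linarith⟩
  have hmul := mul_eq_zero_of_isIdempotentElem_add hai hbi (by rw [hab]; exact h2)
  have hort : inner ℝ a b = 0 := by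
    rw [← hbi.eq, inner_mul_self_right, hmul, inner_zero_left]
  have hn := norm_add_sq_eq_norm_sq_add_norm_sq_of_inner_eq_zero a b hort
  rw [hab] at hn
  have := norm_pos_iff.2 hbn
  nlinarith [norm_nonneg c]

/-- The Peirce `1`-space of a primitive idempotent is one-dimensional. -/
theorem IsPrimitiveIdempotent.eq_smul_of_mul_eq {c x : V} (hc : IsPrimitiveIdempotent c)
    (hx : c * x = x) : ∃ r : ℝ, x = r • c := by
  have hcomm : Commute (lmul V c) (lmul V x) := by
    ext d
    have h := linearized_jordan x c c d
    rw [hc.isIdempotentElem.eq, mul_comm x c, hx] at h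
    simp only [Module.End.mul_apply, lmul_apply]
    have h' : x * (c * d) = c * (x * d) := by
      have e : c * (x * d) = (x * (c * d) + c * (x * d) + c * (x * d)) - x * (c * d)
        - c * (x * d) := by abel
      rw [e, h]
      abel
    exact h'.symm
  obtain ⟨S, p, hp, hp0, hxs, -⟩ := exists_spectral_decomposition x
  have hxc : lmul V x (c - 1) = 0 := by
    rw [lmul_apply, mul_sub, mul_one, mul_comm, hx, sub_self]
  -- For `s ≠ 0`, `X` divides `p s`, so `p s` evaluated at `L_x` kills `c - 1`.
  have hce : ∀ s ∈ S, s ≠ 0 → c * polyEval x (p s) = polyEval x (p s) := by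
    intro s hs h0
    obtain ⟨q, hq⟩ := X_dvd_iff.2 ((coeff_zero_eq_eval_zero _).trans (hp0 s hs h0))
    have h1 : Commute (lmul V c) (aeval (lmul V x) (p s)) :=
      Polynomial.induction_on' (motive := fun q => Commute _ (aeval (lmul V x) q)) (p s)
      (fun p q hp hq => by simpa using hp.add_right hq)
      (fun n a => by
        simpa [aeval_monomial, Algebra.algebraMap_eq_smul_one] using
          (hcomm.pow_right n).smul_right a)
    have h2 := congrArg (fun f : Module.End ℝ V => f 1) h1.eq
    simp only [Module.End.mul_apply, lmul_apply, mul_one] at h2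
    rw [polyEval, h2, ← sub_eq_zero, ← map_sub, hq, mul_comm, map_mul, Module.End.mul_apply,
      aeval_X, hxc, map_zero]
  have hcase : ∀ s ∈ S, ∃ r : ℝ, s • polyEval x (p s) = r • c := by
    intro s hs
    by_cases h0 : s = 0
    · exact ⟨0, by simp [h0]⟩
    set e := polyEval x (p s)
    have hee := hp s hs
    by_cases he0 : e = 0
    · exact ⟨0, by simp [he0]⟩
    -- The splitting `c = e + (c - e)` and primitivity leave only `e = 0` or `e = c`.
    have hid : IsIdempotentElem (c - e) := by
      have h1 := hce s hs h0
      rw [IsIdempotentElem, sub_mul, mul_sub, mul_sub, mul_comm e c, hc.isIdempotentElem.eq,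
        hee.eq, h1]
      abel
    by_cases h1 : c - e = 0
    · exact ⟨s, by rw [sub_eq_zero.1 h1]⟩
    · exact absurd (add_sub_cancel e c) (hc.add_ne _ _ he0 hee h1 hid)
  choose! r hr using hcase
  exact ⟨∑ s ∈ S, r s, by rw [Finset.sum_smul, ← Finset.sum_congr rfl hr]; exact hxs⟩

/-- The cubic identity for `L_c` puts `P_c x` in the Peirce 1-space `ℝ c`; pairing with `c` finds
the coefficient. -/
theorem IsPrimitiveIdempotent.quadraticRep_apply {c : V} (hc : IsPrimitiveIdempotent c) (x : V) :
    quadraticRep c x = (inner ℝ c x / inner ℝ c c : ℝ) • c := by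
  have hi := hc.isIdempotentElem
  have h := congrArg (fun f : Module.End ℝ V => f x) (lmul_mul_mul c c c)
  simp only [hi.eq, LinearMap.sub_apply, LinearMap.add_apply, Module.End.mul_apply,
    lmul_apply] at h
  have hP : c * quadraticRep c x = quadraticRep c x := by
    rw [quadraticRep_apply_idempotent hi, mul_sub, mul_smul_comm, ← sub_eq_zero]
    have e : (2 : ℝ) • (c * (c * (c * x))) - c * (c * x) - ((2 : ℝ) • (c * (c * x)) - c * x) =
      c * x - (c * (c * x) + c * (c * x) + c * (c * x) - c * (c * (c * x)) - c * (c * (c * x))) := by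
      module
    rw [e, ← h, sub_self]
  obtain ⟨r, hr⟩ := hc.eq_smul_of_mul_eq hP
  have h1 : inner ℝ c (quadraticRep c x) = inner ℝ c x := by
    have h2 : ∀ y : V, inner ℝ c (c * y) = inner ℝ c y := fun y => by rw [inner_mul_right, hi.eq]
    rw [quadraticRep_apply_idempotent hi, inner_sub_right, real_inner_smul_right, h2, h2]
    ring
  have h3 : (inner ℝ c c : ℝ) ≠ 0 := (real_inner_self_pos.2 hc.ne_zero).ne'
  rw [hr, real_inner_smul_right] at h1
  rw [hr, ← h1, mul_div_cancel_right₀ _ h3]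

end Cone
end EuclideanJordanAlgebra

namespace EuclideanJordanAlgebra

open Topology

/-! ### Values, optimal pairs and the two implications. -/

section Game

variable {V : Type*} [NormedAddCommGroup V] [InnerProductSpace ℝ V] [EuclideanJordanAlgebra V]
  [FiniteDimensional ℝ V]

theorem exists_isValue (hne : (strategies (symmetricCone V) (1 : V)).Nonempty) (L : V →ₗ[ℝ] V) :
    ∃ v, IsValue (symmetricCone V) (1 : V) L v := by
  have hL : Continuous L := L.continuous_of_finiteDimensional
  -- Sion's theorem minimises over the first argument, so `y` precedes `x`.
  obtain ⟨y, hy, x, hx, h⟩ := Sion.exists_isSaddlePointOn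
    (X := strategies (symmetricCone V) (1 : V)) (Y := strategies (symmetricCone V) (1 : V))
    (f := fun y x => (inner ℝ (L x) y : ℝ)) hne convex_strategies isCompact_strategies
    (fun x _ => (continuous_const.inner continuous_id).lowerSemicontinuous.lowerSemicontinuousOn _)
    (fun x _ => ((innerₗ V (L x)).convexOn convex_strategies).quasiconvexOn)
    convex_strategies hne isCompact_strategies
    (fun y _ => (hL.inner continuous_const).upperSemicontinuous.upperSemicontinuousOn _)
    (fun y _ => by
      rw [show (fun x => (inner ℝ (L x) y : ℝ)) = innerₗ V y ∘ₗ L from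
        funext fun x => real_inner_comm _ _]
      exact ((innerₗ V y ∘ₗ L).concaveOn convex_strategies).quasiconcaveOn)
  exact ⟨_, x, y, ⟨hx, hy, fun x' hx' => h y hy x' hx', fun y' hy' => h y' hy' x hx⟩, rfl⟩

/-- For a game of value `0`, optimal pairs are the pairs of strategies with `L x` in the dual cone
and `y` nonpositive on the image of the cone. -/
theorem isOptimalPair_iff {L : V →ₗ[ℝ] V} (hL : IsValue (symmetricCone V) 1 L 0) {x y : V} :
    IsOptimalPair (symmetricCone V) 1 L x y ↔
      x ∈ strategies (symmetricCone V) 1 ∧ y ∈ strategies (symmetricCone V) 1 ∧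
      (∀ z ∈ symmetricCone V, 0 ≤ inner ℝ (L x) z) ∧
      (∀ z ∈ symmetricCone V, inner ℝ (L z) y ≤ 0) := by
  constructor
  · intro h
    have h0 : (0 : ℝ) = inner ℝ (L x) y := hL.unique ⟨x, y, h, rfl⟩
    refine ⟨h.left_mem, h.right_mem, fun z hz => ?_, fun z hz => ?_⟩
    · exact inner_nonneg_of_strategies (fun w hw => h0 ▸ h.payoff_le w hw) hz
    · have := inner_nonneg_of_strategies (z := -(L.adjoint y)) (fun w hw => ?_) hz
      · rw [inner_neg_left, LinearMap.adjoint_inner_left, real_inner_comm] at this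
        linarith
      · rw [inner_neg_left, LinearMap.adjoint_inner_left, real_inner_comm]
        linarith [h.le_payoff w hw]
  · rintro ⟨hx, hy, h1, h2⟩
    have h0 : inner ℝ (L x) y = 0 := le_antisymm (h2 x hx.1) (h1 y hy.1)
    exact ⟨hx, hy, fun z hz => h0 ▸ h2 z hz.1, fun z hz => h0 ▸ h1 z hz.1⟩

theorem IsPrimitiveIdempotent.inner_quadraticRep {c : V} (hc : IsPrimitiveIdempotent c)
    (x y : V) :
    inner ℝ (quadraticRep c x) y = (inner ℝ c x * inner ℝ c y / inner ℝ c c : ℝ) := by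
  rw [hc.quadraticRep_apply, real_inner_smul_left]
  ring

theorem inner_pos_of_mem_interior {x z : V} (hx : x ∈ interior (symmetricCone V))
    (hz : z ∈ symmetricCone V) (h0 : z ≠ 0) : 0 < inner ℝ z x := by
  have hz' : ∀ y ∈ symmetricCone V, 0 ≤ inner ℝ z y := fun y hy =>
    inner_nonneg_of_mem_symmetricCone hz hy
  exact lt_of_le_of_ne (hz' x (interior_subset hx)) fun h =>
    h0 (eq_zero_of_inner_interior_eq_zero hx hz' h.symm)

/-- A nonzero direction orthogonal to `1` leads from any strategy to the boundary of the cone. -/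
theorem exists_boundary_strategy {y u : V} (hy : y ∈ strategies (symmetricCone V) (1 : V))
    (hu : u ≠ 0) (hu1 : inner ℝ u 1 = 0) :
    ∃ t : ℝ, 0 ≤ t ∧ y + t • u ∈ strategies (symmetricCone V) (1 : V) ∧
      y + t • u ∉ interior (symmetricCone V) := by
  set A : Set ℝ := {t | 0 ≤ t ∧ y + t • u ∈ strategies (symmetricCone V) (1 : V)} with hA
  have hcont : Continuous fun t : ℝ => y + t • u := by fun_prop
  have hcl : IsClosed A :=
    (isClosed_le continuous_const continuous_id).inter
      (isCompact_strategies.isClosed.preimage hcont)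
  have hbd : Bornology.IsBounded A := by
    obtain ⟨R, hR⟩ := (isCompact_strategies (V := V)).isBounded.exists_norm_le
    have hun := norm_pos_iff.2 hu
    refine (Metric.isBounded_closedBall (x := (0 : ℝ)) (r := (R + ‖y‖) / ‖u‖)).subset
      fun t ht => ?_
    rw [mem_closedBall_zero_iff, le_div_iff₀ hun, ← norm_smul]
    calc ‖t • u‖ = ‖(y + t • u) - y‖ := by rw [add_sub_cancel_left]
      _ ≤ ‖y + t • u‖ + ‖y‖ := norm_sub_le _ _
      _ ≤ R + ‖y‖ := by gcongr; exact hR _ ht.2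
  have hcomp := Metric.isCompact_of_isClosed_isBounded hcl hbd
  -- At the largest admissible `t` the point cannot be interior, or the ray could be followed
  -- further.
  obtain ⟨t, ht, hmax⟩ := hcomp.exists_isMaxOn ⟨0, le_rfl, by simpa using hy⟩
    continuous_id.continuousOn
  refine ⟨t, ht.1, ht.2, fun hint => ?_⟩
  have hev : ∀ᶠ s in 𝓝 t, y + s • u ∈ symmetricCone V :=
    hcont.continuousAt.eventually (mem_interior_iff_mem_nhds.1 hint)
  obtain ⟨s, hs, hts⟩ := (hev.filter_mono nhdsWithin_le_nhds |>.and
    (self_mem_nhdsWithin : Set.Ioi t ∈ 𝓝[>] t)).exists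
  have : s ≤ t := hmax ⟨ht.1.trans (le_of_lt hts), hs, by
    rw [inner_add_left, real_inner_smul_left, hu1, hy.2]
    ring⟩
  exact absurd hts (not_lt.2 this)

/-- If `L x = 0`, some direction orthogonal to `a` is mapped by the adjoint of `L` to `0` or to a
prescribed vector orthogonal to `x`. -/
theorem exists_adjoint_direction {E : Type*} [NormedAddCommGroup E] [InnerProductSpace ℝ E]
    [FiniteDimensional ℝ E] {L : E →ₗ[ℝ] E} {x a b : E} (hx : x ≠ 0) (ha : a ≠ 0) (hb : b ≠ 0)
    (hLx : L x = 0) (hbx : inner ℝ x b = 0) :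
    ∃ u : E, u ≠ 0 ∧ inner ℝ u a = 0 ∧ (L.adjoint u = 0 ∨ L.adjoint u = b) := by
  have hmem : ∀ u : E, L.adjoint u ∈ (ℝ ∙ x)ᗮ := fun u => by
    rw [Submodule.mem_orthogonal_singleton_iff_inner_right, LinearMap.adjoint_inner_right, hLx,
      inner_zero_left]
  let T : (ℝ ∙ a)ᗮ →ₗ[ℝ] (ℝ ∙ x)ᗮ := (L.adjoint.comp (ℝ ∙ a)ᗮ.subtype).codRestrict _
    fun u => hmem u
  have hT : ∀ u, (T u : E) = L.adjoint u := fun u => rfl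
  have hfr : Module.finrank ℝ (ℝ ∙ a)ᗮ = Module.finrank ℝ (ℝ ∙ x)ᗮ := by
    have h1 := Submodule.finrank_add_finrank_orthogonal (ℝ ∙ a)
    have h2 := Submodule.finrank_add_finrank_orthogonal (ℝ ∙ x)
    rw [finrank_span_singleton ha] at h1
    rw [finrank_span_singleton hx] at h2
    omega
  have horth : ∀ u : (ℝ ∙ a)ᗮ, inner ℝ (u : E) a = 0 := fun u =>
    Submodule.mem_orthogonal_singleton_iff_inner_left.1 u.2
  -- The hyperplanes `a^⊥` and `x^⊥` have equal dimension: `T` is onto or has a kernel.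
  by_cases hinj : Function.Injective T
  · obtain ⟨u, hu⟩ := (LinearMap.injective_iff_surjective_of_finrank_eq_finrank hfr).1 hinj
      ⟨b, Submodule.mem_orthogonal_singleton_iff_inner_right.2 hbx⟩
    have hub : L.adjoint u = b := by rw [← hT, hu]
    refine ⟨u, fun h0 => hb ?_, horth u, Or.inr hub⟩
    rw [← hub, h0, map_zero]
  · rw [injective_iff_map_eq_zero] at hinj
    push Not at hinj
    obtain ⟨u, hu, hu0⟩ := hinj
    exact ⟨u, by simpa using hu0, horth u, Or.inl (by rw [← hT, hu, ZeroMemClass.coe_zero])⟩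

theorem exists_isValue_add_quadraticRep_pos {L : V →ₗ[ℝ] V}
    (hL : IsValue (symmetricCone V) 1 L 0) (h : IsCompletelyMixed (symmetricCone V) 1 L) {c : V}
    (hc : IsPrimitiveIdempotent c) :
    ∃ v : ℝ, IsValue (symmetricCone V) 1 (L + quadraticRep c) v ∧ 0 < v := by
  obtain ⟨x, y, hxy, -⟩ := id hL
  obtain ⟨hx, hy, h1, h2⟩ := (isOptimalPair_iff hL).1 hxy
  have hxint := (h x y hxy).1
  obtain ⟨v, x', y', hopt, hv⟩ := exists_isValue ⟨x, hx⟩ (L + quadraticRep c)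
  refine ⟨v, ⟨x', y', hopt, hv⟩, ?_⟩
  by_contra! hv0
  have hcc := real_inner_self_pos.2 hc.ne_zero
  have hcx := inner_pos_of_mem_interior hxint hc.mem hc.ne_zero
  have hle : ∀ z ∈ strategies (symmetricCone V) (1 : V),
      inner ℝ (L z) y' + inner ℝ c z * inner ℝ c y' / inner ℝ c c ≤ (0 : ℝ) := fun z hz => by
    have := hopt.le_payoff z hz
    rw [← hv, LinearMap.add_apply, inner_add_left, hc.inner_quadraticRep] at this
    exact this.trans hv0
  have hcy := inner_nonneg_of_mem_symmetricCone hc.mem hopt.right_mem.1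
  -- Dropping the nonnegative rank-one term from `hle` leaves `⟨L z, y'⟩ ≤ 0`.
  have hopt' : IsOptimalPair (symmetricCone V) 1 L x y' := by
    refine (isOptimalPair_iff hL).2 ⟨hx, hopt.right_mem, h1, fun z hz => ?_⟩
    have := inner_nonneg_of_strategies (z := -(L.adjoint y')) (fun w hw => ?_) hz
    · rw [inner_neg_left, LinearMap.adjoint_inner_left, real_inner_comm] at this
      linarith
    · rw [inner_neg_left, LinearMap.adjoint_inner_left, real_inner_comm]
      have hcw := inner_nonneg_of_mem_symmetricCone hc.mem hw.1
      have : 0 ≤ (inner ℝ c w * inner ℝ c y' / inner ℝ c c : ℝ) := by positivity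
      linarith [hle w hw]
  have hcy' := inner_pos_of_mem_interior (h x y' hopt').2 hc.mem hc.ne_zero
  have : 0 < (inner ℝ c x * inner ℝ c y' / inner ℝ c c : ℝ) := by positivity
  linarith [hle x hx, h1 y' hopt.right_mem.1]

theorem isCompletelyMixed_of_pos {L : V →ₗ[ℝ] V} (hL : IsValue (symmetricCone V) 1 L 0)
    (h : ∀ c : V, IsPrimitiveIdempotent c →
      ∃ v : ℝ, IsValue (symmetricCone V) 1 (L + quadraticRep c) v ∧ 0 < v) :
    IsCompletelyMixed (symmetricCone V) 1 L := by
  have hright : ∀ x y : V, IsOptimalPair (symmetricCone V) 1 L x y →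
      y ∈ interior (symmetricCone V) := by
    intro x y hxy
    obtain ⟨-, hy, -, h2⟩ := (isOptimalPair_iff hL).1 hxy
    by_contra hint
    obtain ⟨c, hc, hyc⟩ := exists_isPrimitiveIdempotent_inner_eq_zero hy.1 hint
    obtain ⟨v, ⟨x', y', hopt, hv⟩, hpos⟩ := h c hc
    have h3 := hopt.payoff_le y hy
    rw [← hv, LinearMap.add_apply, inner_add_left, hc.inner_quadraticRep,
      real_inner_comm y c, hyc, mul_zero, zero_div, add_zero] at h3
    linarith [h2 x' hopt.left_mem.1]
  intro x y hxy
  refine ⟨?_, hright x y hxy⟩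
  by_contra hint
  obtain ⟨hx, hy, h1, h2⟩ := (isOptimalPair_iff hL).1 hxy
  have hLx : L x = 0 := eq_zero_of_inner_interior_eq_zero (hright x y hxy) h1
    (le_antisymm (h2 x hx.1) (h1 y hy.1))
  obtain ⟨c, hc0, hci, hxc⟩ := exists_isIdempotentElem_inner_eq_zero hx.1 hint
  have hx0 : x ≠ 0 := by
    rintro rfl
    simpa using hx.2
  have h10 : (1 : V) ≠ 0 := fun h0 => by
    have := hx.2
    rw [h0, inner_zero_right] at this
    exact zero_ne_one this
  -- The sign of `-c` makes `⟨L z, u⟩ ≤ 0` on the cone in either case, so moving `y` along `u`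
  -- preserves optimality.
  obtain ⟨u, hu0, hu1, hu⟩ := exists_adjoint_direction (b := -c) hx0 h10 (neg_ne_zero.2 hc0) hLx
    (by rw [inner_neg_right, hxc, neg_zero])
  obtain ⟨t, ht, hmem, hnot⟩ := exists_boundary_strategy hy hu0 hu1
  refine hnot (hright x _ ((isOptimalPair_iff hL).2 ⟨hx, hmem, h1, fun z hz => ?_⟩))
  have hzu : inner ℝ (L z) u ≤ (0 : ℝ) := by
    rw [← LinearMap.adjoint_inner_right]
    rcases hu with hu | hu <;> rw [hu]
    · rw [inner_zero_right]
    · rw [inner_neg_right, neg_nonpos]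
      exact inner_nonneg_of_mem_symmetricCone hz (isIdempotentElem_mem_symmetricCone hci)
  rw [inner_add_right, real_inner_smul_right]
  have := mul_nonpos_of_nonneg_of_nonpos ht hzu
  linarith [h2 z hz]

end Game
end EuclideanJordanAlgebra

theorem mainTheorem6 {V : Type*} [NormedAddCommGroup V] [InnerProductSpace ℝ V]
    [FiniteDimensional ℝ V] [EuclideanJordanAlgebra V] (L : V →ₗ[ℝ] V)
    (hL : EuclideanJordanAlgebra.IsValue (EuclideanJordanAlgebra.symmetricCone V) 1 L 0) :
    EuclideanJordanAlgebra.IsCompletelyMixed (EuclideanJordanAlgebra.symmetricCone V) 1 L ↔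
      ∀ c : V, EuclideanJordanAlgebra.IsPrimitiveIdempotent c →
        ∃ v : ℝ, EuclideanJordanAlgebra.IsValue (EuclideanJordanAlgebra.symmetricCone V) 1
          (L + EuclideanJordanAlgebra.quadraticRep c) v ∧ 0 < v :=
  ⟨fun h _ hc => EuclideanJordanAlgebra.exists_isValue_add_quadraticRep_pos hL h hc,
    fun h => EuclideanJordanAlgebra.isCompletelyMixed_of_pos hL h⟩
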